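/- Let $K$ be a field and let $Q$ be a finite (finitely many vertices and arrows, multiple arrows allowed), connected (in particular non-empty) and acyclic quiver, and let $A = KQ$ be its path algebra. For $n \ge 1$ let $\vec A_n$ denote the linearly oriented quiver $1 \to 2 \to \cdots \to n$. The dominant dimension $\operatorname{dom.dim} A \in \{0,1,2,\dots\} \cup \{\infty\}$ is the largest $m$ such that the left regular module ${}_AA$ has a minimal injective resolution $0 \to A \to I_1 \to I_2 \to \cdots$ in which $I_1, \dots, I_m$ are all projective; it is $0$ if $I_1$ is not projective, and $\infty$ if there is no largest such $m$. Suppose that $Q$ is not the one-vertex quiver $\vec A_1$. Then $$ \operatorname{dom.dim} A = \begin{cases} 1 & \text{if } Q \cong \vec A_n \text{ for some } n \ge 2,\\ 0 & \text{if } Q \not\cong \vec A_n \text{ for all } n \ge 1. \end{cases} $$ -/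

import Mathlib

/-! ### Quivers -/

/-- An isomorphism of quivers: bijections on vertices and on arrows, compatible with source and
target. -/
structure QuiverIso (V : Type*) (W : Type*) [Quiver V] [Quiver W] where
  onVertices : V ≃ W
  onArrows : ∀ a b : V, (a ⟶ b) ≃ (onVertices a ⟶ onVertices b)

/-- The vertices of the linearly oriented quiver `1 ⟶ 2 ⟶ ⋯ ⟶ n` (numbered from `0`). -/
def LinearQuiver (n : ℕ) : Type := Fin n

/-- There is exactly one arrow `i ⟶ i + 1` for each `i`, and there are no other arrows. -/
instance LinearQuiver.instQuiver (n : ℕ) : Quiver (LinearQuiver n) :=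
  ⟨fun i j => PLift (Fin.val i + 1 = Fin.val j)⟩

/-- A quiver is connected if it is non-empty and any two vertices are joined by a walk that may
traverse arrows in both directions. -/
def QuiverConnected (V : Type*) [Quiver V] : Prop :=
  Nonempty V ∧ Quiver.IsStronglyConnected (Quiver.Symmetrify V)

/-- A quiver is acyclic if it has no oriented cycle of positive length. -/
def QuiverAcyclic (V : Type*) [Quiver V] : Prop :=
  ∀ (a : V) (p : Quiver.Path a a), p.length = 0

/-! ### The path algebra -/

/-- All paths of a quiver (source, target, path), including the trivial path at each vertex. -/
abbrev QuiverPath (V : Type*) [Quiver V] := Σ a b : V, Quiver.Path a b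

/-- The path algebra `K V`: the vector space with basis the set of all paths. -/
def PathAlgebra (K : Type*) (V : Type*) [Field K] [Quiver V] := QuiverPath V →₀ K

namespace PathAlgebra

variable {K : Type*} {V : Type*} [Field K] [Quiver V]

noncomputable instance : AddCommGroup (PathAlgebra K V) :=
  inferInstanceAs (AddCommGroup (QuiverPath V →₀ K))

noncomputable instance : Module K (PathAlgebra K V) :=
  inferInstanceAs (Module K (QuiverPath V →₀ K))

/-- The basis element given by a path. -/
noncomputable def ofPath (p : QuiverPath V) : PathAlgebra K V :=
  (Finsupp.single p 1 : QuiverPath V →₀ K)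

open Classical in
/-- The product `p q` of two paths: first `q`, then `p`, if `q` ends where `p` starts, and zero
otherwise. -/
noncomputable def pathMul (p q : QuiverPath V) : PathAlgebra K V :=
  if h : q.2.1 = p.1 then ofPath ⟨q.1, p.2.1, (q.2.2.cast rfl h).comp p.2.2⟩ else 0

/-- The bilinear extension of the product of paths. -/
noncomputable def mulHom : PathAlgebra K V →ₗ[K] PathAlgebra K V →ₗ[K] PathAlgebra K V :=
  Finsupp.linearCombination K fun p : QuiverPath V =>
    (Finsupp.linearCombination K fun q : QuiverPath V => (pathMul p q : PathAlgebra K V) :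
      PathAlgebra K V →ₗ[K] PathAlgebra K V)

noncomputable instance : Mul (PathAlgebra K V) := ⟨fun x y => mulHom x y⟩

/-- The unit is the sum of the trivial paths. -/
noncomputable instance [Fintype V] : One (PathAlgebra K V) :=
  ⟨∑ a : V, ofPath ⟨a, a, Quiver.Path.nil⟩⟩

theorem mul_def (x y : PathAlgebra K V) : x * y = mulHom x y := rfl

theorem one_def [Fintype V] :
    (1 : PathAlgebra K V) = ∑ a : V, ofPath ⟨a, a, Quiver.Path.nil⟩ := rfl

theorem mulHom_ofPath (p q : QuiverPath V) :
    mulHom (ofPath p) (ofPath q) = (pathMul p q : PathAlgebra K V) := by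
  have h : mulHom (ofPath p) = (Finsupp.linearCombination K
      fun q : QuiverPath V => (pathMul p q : PathAlgebra K V) :
      PathAlgebra K V →ₗ[K] PathAlgebra K V) := by
    refine (Finsupp.linearCombination_single K (1 : K) p).trans ?_
    exact one_smul K _
  rw [h]
  refine (Finsupp.linearCombination_single K (1 : K) q).trans ?_
  exact one_smul K _

theorem pathMul_comp {a b c : V} (p : Quiver.Path b c) (q : Quiver.Path a b) :
    (pathMul ⟨b, c, p⟩ ⟨a, b, q⟩ : PathAlgebra K V) = ofPath ⟨a, c, q.comp p⟩ := by
  simp [pathMul]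

theorem pathMul_ne {p q : QuiverPath V} (h : q.2.1 ≠ p.1) :
    (pathMul p q : PathAlgebra K V) = 0 := by
  simp [pathMul, h]

theorem induction_linear {P : PathAlgebra K V → Prop} (x : PathAlgebra K V) (h0 : P 0)
    (hadd : ∀ x y, P x → P y → P (x + y)) (hsmul : ∀ (c : K) p, P (c • ofPath p)) : P x := by
  refine Finsupp.induction_linear (motive := P) x h0 hadd fun p c => ?_
  have h : (Finsupp.single p c : QuiverPath V →₀ K) = c • Finsupp.single p (1 : K) := by simp
  rw [h]
  exact hsmul c p

theorem mulHom_assoc_ofPath (p q r : QuiverPath V) :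
    mulHom (mulHom (ofPath p) (ofPath q)) (ofPath r) =
      (mulHom (ofPath p) (mulHom (ofPath q) (ofPath r)) : PathAlgebra K V) := by
  obtain ⟨c, d, p⟩ := p
  obtain ⟨b, c', q⟩ := q
  obtain ⟨a, b', r⟩ := r
  rw [mulHom_ofPath, mulHom_ofPath]
  by_cases h1 : c' = c
  · subst h1
    rw [pathMul_comp, mulHom_ofPath]
    by_cases h2 : b' = b
    · subst h2
      rw [pathMul_comp, pathMul_comp, mulHom_ofPath, pathMul_comp, Quiver.Path.comp_assoc]
    · rw [pathMul_ne h2, pathMul_ne h2, map_zero]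
  · rw [pathMul_ne h1, map_zero, LinearMap.zero_apply]
    by_cases h2 : b' = b
    · subst h2
      rw [pathMul_comp, mulHom_ofPath, pathMul_ne h1]
    · rw [pathMul_ne h2, map_zero]

theorem mulHom_assoc (x y z : PathAlgebra K V) :
    mulHom (mulHom x y) z = mulHom x (mulHom y z) := by
  induction x using induction_linear with
  | h0 => simp
  | hadd x x' hx hx' => simp [hx, hx']
  | hsmul c p =>
    induction y using induction_linear with
    | h0 => simp
    | hadd y y' hy hy' => simp only [map_add, LinearMap.add_apply, hy, hy']
    | hsmul d q =>
      induction z using induction_linear with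
      | h0 => simp
      | hadd z z' hz hz' => simp only [map_add, hz, hz']
      | hsmul e r => simp only [map_smul, LinearMap.smul_apply, mulHom_assoc_ofPath]

theorem mulHom_one_left [Fintype V] (x : PathAlgebra K V) : mulHom 1 x = x := by
  induction x using induction_linear with
  | h0 => simp
  | hadd x y hx hy => rw [map_add, hx, hy]
  | hsmul c p =>
    obtain ⟨a, b, p⟩ := p
    rw [map_smul, one_def, map_sum, LinearMap.sum_apply, Finset.sum_eq_single b]
    · rw [mulHom_ofPath, pathMul_comp, Quiver.Path.comp_nil]
    · intro v _ hv
      rw [mulHom_ofPath, pathMul_ne (Ne.symm hv)]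
    · intro h
      exact absurd (Finset.mem_univ b) h

theorem mulHom_one_right [Fintype V] (x : PathAlgebra K V) : mulHom x 1 = x := by
  induction x using induction_linear with
  | h0 => simp
  | hadd x y hx hy => rw [map_add, LinearMap.add_apply, hx, hy]
  | hsmul c p =>
    obtain ⟨a, b, p⟩ := p
    rw [map_smul, LinearMap.smul_apply, one_def, map_sum, Finset.sum_eq_single a]
    · rw [mulHom_ofPath, pathMul_comp, Quiver.Path.nil_comp]
    · intro v _ hv
      rw [mulHom_ofPath, pathMul_ne hv]
    · intro h
      exact absurd (Finset.mem_univ a) h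

noncomputable instance [Fintype V] : Ring (PathAlgebra K V) where
  __ := (inferInstance : AddCommGroup (PathAlgebra K V))
  left_distrib x y z := map_add (mulHom x) y z
  right_distrib x y z := by simp only [mul_def, map_add, LinearMap.add_apply]
  zero_mul x := by simp only [mul_def, map_zero, LinearMap.zero_apply]
  mul_zero x := map_zero (mulHom x)
  mul_assoc := mulHom_assoc
  one_mul := mulHom_one_left
  mul_one := mulHom_one_right

noncomputable instance [Fintype V] : Algebra K (PathAlgebra K V) :=
  Algebra.ofModule (fun c x y => by simp only [mul_def, map_smul, LinearMap.smul_apply])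
    (fun c x y => by simp only [mul_def, map_smul])

end PathAlgebra

/-! ### Dominant dimension -/

section DominantDimension

open CategoryTheory

universe u v

/-- A submodule is essential if it meets every non-zero submodule non-trivially. -/
def IsEssentialSubmodule {A : Type u} [Ring A] {M : Type v} [AddCommGroup M] [Module A M]
    (N : Submodule A M) : Prop :=
  ∀ L : Submodule A M, L ⊓ N = ⊥ → L = ⊥

/-- An injective resolution `0 ⟶ M ⟶ I⁰ ⟶ I¹ ⟶ ⋯` is minimal if the kernel of each
`Iʲ ⟶ Iʲ⁺¹`, which by exactness is the image of the preceding map (of `M ⟶ I⁰` for `j = 0`), is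
essential in `Iʲ`; that is, `Iʲ` is an injective envelope of that image. -/
def IsMinimalInjectiveResolution {A : Type u} [Ring A] {M : ModuleCat.{v} A}
    (I : InjectiveResolution M) : Prop :=
  ∀ j : ℕ, IsEssentialSubmodule (LinearMap.ker (I.cocomplex.d j (j + 1)).hom)

/-- `M` has dominant dimension at least `n`: some minimal injective resolution of `M` has its first
`n` terms projective (they are injective anyway). -/
def DominantDimensionGE {A : Type u} [Ring A] (M : ModuleCat.{v} A) (n : ℕ) : Prop :=
  ∃ I : InjectiveResolution M, IsMinimalInjectiveResolution I ∧
    ∀ j < n, Projective (I.cocomplex.X j)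

/-- The dominant dimension of a module: the largest `n` such that the dominant dimension is at
least `n`, and `⊤` if there is no largest one. -/
noncomputable def moduleDominantDimension {A : Type u} [Ring A] (M : ModuleCat.{v} A) : ℕ∞ :=
  ⨆ (n : ℕ) (_ : DominantDimensionGE M n), (n : ℕ∞)

/-- The dominant dimension of a ring: that of its left regular module. -/
noncomputable def dominantDimension (A : Type u) [Ring A] : ℕ∞ :=
  moduleDominantDimension (ModuleCat.of A A)

end DominantDimension

/-! Left `A`-modules are representations of `Q`: an arrow `α : a ⟶ b` maps `e_a M` to `e_b M`. Two
dual facts about arrows carry the bounds. Appending an arrow is injective on paths, and distinct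
arrows produce distinct last steps; hence on a projective module, which sits in a free one, each `α`
is injective on `e_a M` and distinct arrows have images meeting in zero. On an injective module `N`,
independence of arrows as first steps gives solvability: each `α` maps onto `e_b N`, and for
distinct `α`, `β` one can even prescribe `α y = 0` and `β y = z`.

Let `A` embed in an injective `N`. If `N` is also projective, distinct arrows with a common source
contradict injectivity of arrows, and distinct arrows with a common target both hit the image of
`e_c`, contradicting independence of images. So every vertex has at most one arrow in and one out,
and a connected acyclic quiver of this kind is linear (`exists_quiverIso_linearQuiver`). Whenever
there is an arrow `β : a ⟶ b`, the second term of a resolution is not projective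
(`not_projective_of_ker_eq_range`): solving `β y = e_b` in `N` gives an element of `N/A` at `a`
killed by `β`, and it is nonzero because `e_b` is not in `β A`. This bounds the dominant dimension
by one.

For a linear quiver, `A` is the algebra of triangular matrices inside all square matrices. Each
column is the thin module, which is projective (`A e_s` for the source `s`) and injective (the dual
of `e_t A` for the sink `t`). The quotient is a product of truncated columns, each zero or dual to
some `e_b A`, hence injective. This two-term resolution is minimal because every nonzero matrix can
be pushed into the row of `t`. -/

/-! ### Coefficients in the path algebra -/

namespace PathAlgebra

variable {K : Type*} {V : Type*} [Field K] [Quiver V]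

/-- The coefficient of an element of the path algebra at a path. -/
noncomputable def coeff (p : QuiverPath V) : PathAlgebra K V →ₗ[K] K :=
  (Finsupp.lapply p : (QuiverPath V →₀ K) →ₗ[K] K)

/-- The basis element given by the trivial path at a vertex. -/
noncomputable def vertex (K : Type*) {V : Type*} [Field K] [Quiver V] (a : V) :
    PathAlgebra K V :=
  ofPath ⟨a, a, Quiver.Path.nil⟩

/-- The basis element given by an arrow. -/
noncomputable def arrow (K : Type*) {V : Type*} [Field K] [Quiver V] {a b : V} (α : a ⟶ b) :
    PathAlgebra K V :=
  ofPath ⟨a, b, α.toPath⟩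

theorem ext_coeff {x y : PathAlgebra K V} (h : ∀ p, coeff p x = coeff p y) : x = y :=
  Finsupp.ext h

open Classical in
theorem coeff_ofPath (p q : QuiverPath V) :
    coeff p (ofPath q : PathAlgebra K V) = if q = p then 1 else 0 :=
  Finsupp.single_apply

theorem coeff_ofPath_self (p : QuiverPath V) : coeff p (ofPath p : PathAlgebra K V) = 1 := by
  simp [coeff_ofPath]

theorem coeff_ofPath_of_ne {p q : QuiverPath V} (h : q ≠ p) :
    coeff p (ofPath q : PathAlgebra K V) = 0 := by
  simp [coeff_ofPath, h]

theorem ofPath_mul_ofPath (p q : QuiverPath V) :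
    (ofPath p * ofPath q : PathAlgebra K V) = pathMul p q :=
  mulHom_ofPath p q

theorem ofPath_mul_comp {a b c : V} (p : Quiver.Path b c) (q : Quiver.Path a b) :
    (ofPath ⟨b, c, p⟩ * ofPath ⟨a, b, q⟩ : PathAlgebra K V) = ofPath ⟨a, c, q.comp p⟩ := by
  rw [ofPath_mul_ofPath, pathMul_comp]

/-- Two linear maps agree if they do so on all paths. -/
theorem eq_of_eq_ofPath {M : Type*} [AddCommGroup M] [Module K M]
    {f g : PathAlgebra K V →ₗ[K] M} (h : ∀ p, f (ofPath p) = g (ofPath p)) : f = g := by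
  ext x
  induction x using induction_linear with
  | h0 => simp
  | hadd x y hx hy => rw [map_add, map_add, hx, hy]
  | hsmul c p => rw [map_smul, map_smul, h]

theorem vertex_mul_vertex (a : V) : vertex K a * vertex K a = vertex K a :=
  ofPath_mul_comp _ _

theorem vertex_mul_arrow {a b : V} (α : a ⟶ b) : vertex K b * arrow K α = arrow K α :=
  ofPath_mul_comp _ _

theorem arrow_mul_vertex {a b : V} (α : a ⟶ b) : arrow K α * vertex K a = arrow K α := by
  rw [arrow, vertex, ofPath_mul_comp, Quiver.Path.nil_comp]

variable [Fintype V]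

/-- Appending `α` at the end is injective on paths ending at `a`, so no two terms of `x` contribute
to the same coefficient. -/
theorem coeff_cons_arrow_mul {a b c : V} (α : a ⟶ b) (p : Quiver.Path c a)
    (x : PathAlgebra K V) : coeff ⟨c, b, p.cons α⟩ (arrow K α * x) = coeff ⟨c, a, p⟩ x := by
  refine LinearMap.congr_fun (f := coeff _ ∘ₗ LinearMap.mulLeft K (arrow K α)) ?_ x
  refine eq_of_eq_ofPath fun ⟨c', a', q⟩ => ?_
  simp only [LinearMap.comp_apply, LinearMap.mulLeft_apply, arrow, ofPath_mul_ofPath]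
  by_cases h : a' = a
  · subst h
    rw [pathMul_comp, coeff_ofPath, coeff_ofPath, Quiver.Path.comp_toPath_eq_cons]
    congr 1
    apply propext
    constructor
    · intro h
      cases h
      rfl
    · intro h
      cases h
      rfl
  · rw [pathMul_ne h, map_zero, coeff_ofPath_of_ne]
    rintro h'
    cases h'
    exact h rfl

theorem coeff_arrow_mul_of_forall_ne {a b : V} (α : a ⟶ b) (p : QuiverPath V)
    (hp : ∀ (c : V) (q : Quiver.Path c a), (⟨c, b, q.cons α⟩ : QuiverPath V) ≠ p)
    (x : PathAlgebra K V) : coeff p (arrow K α * x) = 0 := by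
  refine LinearMap.congr_fun (f := coeff p ∘ₗ LinearMap.mulLeft K (arrow K α)) (g := 0) ?_ x
  refine eq_of_eq_ofPath fun ⟨c', a', q⟩ => ?_
  simp only [LinearMap.comp_apply, LinearMap.mulLeft_apply, arrow, ofPath_mul_ofPath,
    LinearMap.zero_apply]
  by_cases h : a' = a
  · subst h
    rw [pathMul_comp, coeff_ofPath_of_ne]
    exact hp _ _
  · rw [pathMul_ne h, map_zero]

/-- Right multiplication prepends `α`, again injectively on paths. -/
theorem coeff_comp_mul_arrow {a b c : V} (α : a ⟶ b) (p : Quiver.Path b c)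
    (x : PathAlgebra K V) :
    coeff ⟨a, c, α.toPath.comp p⟩ (x * arrow K α) = coeff ⟨b, c, p⟩ x := by
  refine LinearMap.congr_fun (f := coeff _ ∘ₗ LinearMap.mulRight K (arrow K α)) ?_ x
  refine eq_of_eq_ofPath fun ⟨b', c', q⟩ => ?_
  simp only [LinearMap.comp_apply, LinearMap.mulRight_apply, arrow, ofPath_mul_ofPath]
  by_cases h : b' = b
  · subst h
    rw [pathMul_comp, coeff_ofPath, coeff_ofPath]
    congr 1
    apply propext
    constructor
    · intro h
      obtain rfl : c' = c := congrArg (fun r : QuiverPath V => r.2.1) h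
      simp only [Sigma.mk.injEq, heq_eq_eq, true_and, Quiver.Path.comp_inj_right] at h
      rw [h]
    · intro h
      cases h
      rfl
  · rw [pathMul_ne (Ne.symm h), map_zero, coeff_ofPath_of_ne]
    rintro h'
    cases h'
    exact h rfl

theorem coeff_mul_arrow_of_forall_ne {a b : V} (α : a ⟶ b) (p : QuiverPath V)
    (hp : ∀ (c : V) (q : Quiver.Path b c), (⟨a, c, α.toPath.comp q⟩ : QuiverPath V) ≠ p)
    (x : PathAlgebra K V) : coeff p (x * arrow K α) = 0 := by
  refine LinearMap.congr_fun (f := coeff p ∘ₗ LinearMap.mulRight K (arrow K α)) (g := 0) ?_ x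
  refine eq_of_eq_ofPath fun ⟨b', c', q⟩ => ?_
  simp only [LinearMap.comp_apply, LinearMap.mulRight_apply, arrow, ofPath_mul_ofPath,
    LinearMap.zero_apply]
  by_cases h : b' = b
  · subst h
    rw [pathMul_comp, coeff_ofPath_of_ne]
    exact hp _ _
  · rw [pathMul_ne (Ne.symm h), map_zero]

open Classical in
theorem coeff_vertex_mul (a : V) (p : QuiverPath V) (x : PathAlgebra K V) :
    coeff p (vertex K a * x) = if p.2.1 = a then coeff p x else 0 := by
  refine LinearMap.congr_fun (f := coeff p ∘ₗ LinearMap.mulLeft K (vertex K a))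
    (g := (if p.2.1 = a then 1 else 0 : K) • coeff p) ?_ x |>.trans
      (by rw [LinearMap.smul_apply]; split_ifs <;> simp)
  refine eq_of_eq_ofPath fun ⟨c, b, q⟩ => ?_
  simp only [LinearMap.comp_apply, LinearMap.mulLeft_apply, vertex, ofPath_mul_ofPath,
    LinearMap.smul_apply]
  by_cases h : b = a
  · subst h
    rw [pathMul_comp, Quiver.Path.comp_nil, coeff_ofPath]
    split_ifs with h1 h2 <;> simp
    subst h1
    exact h2 rfl
  · rw [pathMul_ne h, map_zero, coeff_ofPath]
    split_ifs with h1 h2 <;> simp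
    subst h2
    exact h h1

open Classical in
theorem coeff_mul_vertex (a : V) (p : QuiverPath V) (x : PathAlgebra K V) :
    coeff p (x * vertex K a) = if p.1 = a then coeff p x else 0 := by
  refine LinearMap.congr_fun (f := coeff p ∘ₗ LinearMap.mulRight K (vertex K a))
    (g := (if p.1 = a then 1 else 0 : K) • coeff p) ?_ x |>.trans
      (by rw [LinearMap.smul_apply]; split_ifs <;> simp)
  refine eq_of_eq_ofPath fun ⟨b, c, q⟩ => ?_
  simp only [LinearMap.comp_apply, LinearMap.mulRight_apply, vertex, ofPath_mul_ofPath,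
    LinearMap.smul_apply]
  by_cases h : b = a
  · subst h
    rw [pathMul_comp, Quiver.Path.nil_comp, coeff_ofPath]
    split_ifs with h1 h2 <;> simp
    subst h1
    exact h2 rfl
  · rw [pathMul_ne (Ne.symm h), map_zero, coeff_ofPath]
    split_ifs with h1 h2 <;> simp
    subst h2
    exact h h1

theorem vertex_ne_zero (a : V) : vertex K a ≠ 0 := by
  intro h
  have := coeff_ofPath_self (K := K) (⟨a, a, Quiver.Path.nil⟩ : QuiverPath V)
  rw [← vertex, h, map_zero] at this
  exact zero_ne_one this

/-- Every coefficient of `x` at a path ending at `a` reappears as a coefficient of `α x`. This is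
the free case of injectivity of arrows on projective modules. -/
theorem vertex_mul_eq_zero_of_arrow_mul_eq_zero {a b : V} (α : a ⟶ b) {x : PathAlgebra K V}
    (h : arrow K α * x = 0) : vertex K a * x = 0 := by
  classical
  refine ext_coeff fun ⟨c, d, p⟩ => ?_
  rw [coeff_vertex_mul, map_zero]
  split_ifs with hd
  · dsimp only at hd
    subst hd
    rw [← coeff_cons_arrow_mul α, h, map_zero]
  · rfl

theorem mul_vertex_eq_zero_of_mul_arrow_eq_zero {a b : V} (α : a ⟶ b) {x : PathAlgebra K V}
    (h : x * arrow K α = 0) : x * vertex K b = 0 := by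
  classical
  refine ext_coeff fun ⟨c, d, p⟩ => ?_
  rw [coeff_mul_vertex, map_zero]
  split_ifs with hd
  · dsimp only at hd
    subst hd
    rw [← coeff_comp_mul_arrow α, h, map_zero]
  · rfl

/-- The right ideals generated by two distinct arrows meet trivially. -/
theorem arrow_mul_eq_zero_of_eq {a a' b b' : V} (α : a ⟶ b) (β : a' ⟶ b')
    (hne : (⟨a, b, α⟩ : Σ a b : V, a ⟶ b) ≠ ⟨a', b', β⟩) {x y : PathAlgebra K V}
    (h : arrow K α * x = arrow K β * y) : arrow K α * x = 0 := by
  refine ext_coeff fun p => ?_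
  rw [map_zero]
  by_cases hp : ∀ (c : V) (q : Quiver.Path c a), (⟨c, b, q.cons α⟩ : QuiverPath V) ≠ p
  · exact coeff_arrow_mul_of_forall_ne α p hp x
  · push Not at hp
    obtain ⟨c, q, rfl⟩ := hp
    rw [h]
    refine coeff_arrow_mul_of_forall_ne β _ (fun c' q' h' => hne ?_) y
    cases h'
    rfl

/-- The left ideals generated by two distinct arrows meet trivially. -/
theorem mul_arrow_eq_zero_of_eq {a a' b b' : V} (α : a ⟶ b) (β : a' ⟶ b')
    (hne : (⟨a, b, α⟩ : Σ a b : V, a ⟶ b) ≠ ⟨a', b', β⟩) {x y : PathAlgebra K V}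
    (h : x * arrow K α = y * arrow K β) : x * arrow K α = 0 := by
  refine ext_coeff fun p => ?_
  rw [map_zero]
  by_cases hp : ∀ (c : V) (q : Quiver.Path b c), (⟨a, c, α.toPath.comp q⟩ : QuiverPath V) ≠ p
  · exact coeff_mul_arrow_of_forall_ne α p hp x
  · push Not at hp
    obtain ⟨c, q, rfl⟩ := hp
    rw [h]
    refine coeff_mul_arrow_of_forall_ne β _ (fun c' q' h' => hne ?_) y
    obtain rfl : a' = a := congrArg (fun r : QuiverPath V => r.1) h'
    obtain rfl : c' = c := congrArg (fun r : QuiverPath V => r.2.1) h'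
    simp only [Sigma.mk.injEq, heq_eq_eq, true_and] at h'
    -- The target of the first arrow is the second entry of the vertex list of the path.
    have hb : b' = b := by
      have key : ∀ {u v w : V} (γ : u ⟶ v) (r : Quiver.Path v w),
          (γ.toPath.comp r).vertices[1]? = some v := by
        intro u v w γ r
        rw [Quiver.Path.vertices_comp, Quiver.Path.vertices_toPath]
        simp
      have h3 := key β q'
      rw [h', key α q] at h3
      exact (Option.some.inj h3).symm
    subst hb
    have hl : β.toPath.length = α.toPath.length := rfl
    have := (Quiver.Path.comp_inj' hl).1 h'
    have h4 := eq_of_heq (Quiver.Path.hom_heq_of_cons_eq_cons this.1)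
    rw [h4]

end PathAlgebra

/-! ### Arrows acting on injective and projective modules -/

section

universe u uK uV w

/-- In an injective module, one can simultaneously solve `α • y = 0` and `β • y = z`, provided that
`α` and `β` are left independent, up to the idempotents `e` and `f`. -/
theorem Module.Injective.exists_smul_eq {A N : Type u} [Ring A] [AddCommGroup N] [Module A N]
    (hN : Module.Injective A N) {α β e f : A} (hα : e * α = α) (hβ : f * β = β)
    (he : e * e = e) (hf : f * f = f)
    (h : ∀ x x' : A, x * α + x' * β = 0 → x * e = 0 ∧ x' * f = 0) {z : N} (hz : f • z = z) :
    ∃ y : N, α • y = 0 ∧ β • y = z := by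
  -- The hypothesis `h` controls only `x e` and `x' f`; the coordinates `x (1 - e)` and `x' (1 - f)`
  -- make the map injective. Extending `(x, x') ↦ x' z` along it, `y` is the value at `(1, 0, 0)`,
  -- and the two equations come from `(e, 0)` and `(0, f)`.
  let i : A × A →ₗ[A] A × A × A :=
    ((LinearMap.toSpanSingleton A A α).coprod (LinearMap.toSpanSingleton A A β)).prod
      ((LinearMap.toSpanSingleton A A (1 - e)).prodMap (LinearMap.toSpanSingleton A A (1 - f)))
  have hi : ∀ x x' : A, i (x, x') = (x * α + x' * β, x * (1 - e), x' * (1 - f)) :=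
    fun x x' => rfl
  have hinj : Function.Injective i := by
    rw [← LinearMap.ker_eq_bot, LinearMap.ker_eq_bot']
    rintro ⟨x, x'⟩ hx
    rw [hi, Prod.mk_eq_zero, Prod.mk_eq_zero, mul_sub, mul_sub, mul_one, mul_one] at hx
    obtain ⟨h1, h2⟩ := h x x' hx.1
    rw [h1, h2, sub_zero, sub_zero] at hx
    exact Prod.mk_eq_zero.2 hx.2
  obtain ⟨g, hg⟩ := hN.out i hinj ((LinearMap.toSpanSingleton A N z) ∘ₗ LinearMap.snd A A A)
  refine ⟨g (1, 0, 0), ?_, ?_⟩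
  · have := hg (e, 0)
    rw [hi, hα, mul_sub, mul_one, he, sub_self, zero_mul, add_zero, zero_mul] at this
    rw [← map_smul, Prod.smul_mk, Prod.smul_mk, smul_eq_mul, mul_one, smul_zero]
    simpa using this
  · have := hg (0, f)
    rw [hi, hβ, zero_mul, zero_add, zero_mul, mul_sub, mul_one, hf, sub_self] at this
    rw [← map_smul, Prod.smul_mk, Prod.smul_mk, smul_eq_mul, mul_one, smul_zero]
    simpa [hz] using this

namespace PathAlgebra

section Projective

variable {K : Type*} {V : Type*} [Field K] [Quiver V] [Fintype V]
  {M : Type*} [AddCommGroup M] [Module (PathAlgebra K V) M]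

/-- A projective module embeds in a free one, so the claim is checked coordinatewise in the path
algebra. -/
theorem vertex_smul_eq_zero_of_arrow_smul_eq_zero (hM : Module.Projective (PathAlgebra K V) M)
    {a b : V} (α : a ⟶ b) {x : M} (h : arrow K α • x = 0) : vertex K a • x = 0 := by
  obtain ⟨s, hs⟩ := hM.out
  refine hs.injective ?_
  rw [map_smul, map_zero]
  refine Finsupp.ext fun m => vertex_mul_eq_zero_of_arrow_mul_eq_zero α ?_
  have := DFunLike.congr_fun (congrArg s h) m
  rwa [map_smul, map_zero] at this

theorem arrow_smul_eq_zero_of_eq (hM : Module.Projective (PathAlgebra K V) M)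
    {a a' b b' : V} (α : a ⟶ b) (β : a' ⟶ b')
    (hne : (⟨a, b, α⟩ : Σ a b : V, a ⟶ b) ≠ ⟨a', b', β⟩) {x y : M}
    (h : arrow K α • x = arrow K β • y) : arrow K α • x = 0 := by
  obtain ⟨s, hs⟩ := hM.out
  refine hs.injective ?_
  rw [map_smul, map_zero]
  refine Finsupp.ext fun m => arrow_mul_eq_zero_of_eq α β hne (y := s y m) ?_
  have := DFunLike.congr_fun (congrArg s h) m
  rwa [map_smul, map_smul] at this

end Projective

section Injective

variable {K : Type uK} {V : Type uV} [Field K] [Quiver.{w} V] [Fintype V]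

/-- Degenerate case `α = e = 0` of `Module.Injective.exists_smul_eq`. -/
theorem exists_arrow_smul_eq {N : Type max uK uV w} [AddCommGroup N] [Module (PathAlgebra K V) N]
    (hN : Module.Injective (PathAlgebra K V) N) {a b : V} (β : a ⟶ b) {z : N}
    (hz : vertex K b • z = z) : ∃ y : N, arrow K β • y = z := by
  obtain ⟨y, -, hy⟩ := hN.exists_smul_eq (α := 0) (e := 0) (mul_zero _) (vertex_mul_arrow β)
    (mul_zero _) (vertex_mul_vertex b)
    (fun x x' hx => ⟨mul_zero _, mul_vertex_eq_zero_of_mul_arrow_eq_zero β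
      (by rwa [mul_zero, zero_add] at hx)⟩) hz
  exact ⟨y, hy⟩

theorem exists_arrow_smul_eq_zero_and_eq {N : Type max uK uV w} [AddCommGroup N]
    [Module (PathAlgebra K V) N] (hN : Module.Injective (PathAlgebra K V) N) {a b a' b' : V}
    (α : a ⟶ b) (β : a' ⟶ b') (hne : (⟨a, b, α⟩ : Σ a b : V, a ⟶ b) ≠ ⟨a', b', β⟩) {z : N}
    (hz : vertex K b' • z = z) : ∃ y : N, arrow K α • y = 0 ∧ arrow K β • y = z := by
  refine hN.exists_smul_eq (vertex_mul_arrow α) (vertex_mul_arrow β) (vertex_mul_vertex b)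
    (vertex_mul_vertex b') (fun x x' hx => ?_) hz
  have h1 : x * arrow K α = (-x') * arrow K β := by
    rw [neg_mul]; exact eq_neg_of_add_eq_zero_left hx
  have h2 := mul_arrow_eq_zero_of_eq α β hne h1
  rw [h2, zero_add] at hx
  exact ⟨mul_vertex_eq_zero_of_mul_arrow_eq_zero α h2,
    mul_vertex_eq_zero_of_mul_arrow_eq_zero β hx⟩

variable {N : Type max uK uV w} [AddCommGroup N] [Module (PathAlgebra K V) N]

/-- If the regular module embeds into a projective and injective module, then distinct arrows have
distinct sources. -/
theorem arrow_eq_of_source_eq (hN : Module.Injective (PathAlgebra K V) N)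
    {i : PathAlgebra K V →ₗ[PathAlgebra K V] N} (hi : Function.Injective i)
    (hP : Module.Projective (PathAlgebra K V) N) {a b c : V} (α : a ⟶ b)
    (β : a ⟶ c) : (⟨b, α⟩ : Σ b : V, a ⟶ b) = ⟨c, β⟩ := by
  by_contra hne
  obtain ⟨y, hy, hy'⟩ := exists_arrow_smul_eq_zero_and_eq hN α β
    (fun h => hne (eq_of_heq (Sigma.mk.inj h).2)) (z := i (vertex K c))
    (by rw [← map_smul, smul_eq_mul, vertex_mul_vertex])
  -- Since `α y = 0`, projectivity kills `y` at the common source, so `β y = β e_a y` vanishes as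
  -- well, although it was chosen to be the image of `e_c`.
  have h0 := vertex_smul_eq_zero_of_arrow_smul_eq_zero hP α hy
  rw [← arrow_mul_vertex, mul_smul, h0, smul_zero] at hy'
  exact vertex_ne_zero c (hi (by rw [← hy', map_zero]))

/-- If the regular module embeds into a projective and injective module, then distinct arrows have
distinct targets. -/
theorem arrow_eq_of_target_eq (hN : Module.Injective (PathAlgebra K V) N)
    {i : PathAlgebra K V →ₗ[PathAlgebra K V] N} (hi : Function.Injective i)
    (hP : Module.Projective (PathAlgebra K V) N) {a b c : V} (α : a ⟶ c)
    (β : b ⟶ c) : (⟨a, α⟩ : Σ a : V, a ⟶ c) = ⟨b, β⟩ := by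
  by_contra hne
  have hz : vertex K c • i (vertex K c) = i (vertex K c) := by
    rw [← map_smul, smul_eq_mul, vertex_mul_vertex]
  obtain ⟨y, hy⟩ := exists_arrow_smul_eq hN α hz
  obtain ⟨y', hy'⟩ := exists_arrow_smul_eq hN β hz
  have h0 := arrow_smul_eq_zero_of_eq hP α β (fun h => hne (by cases h; rfl)) (hy.trans hy'.symm)
  exact vertex_ne_zero c (hi (by rw [← hy, h0, map_zero]))

/-- If the quiver has an arrow, then the cokernel of an embedding of the regular module into an
injective module does not embed into a projective module. -/
theorem not_projective_of_ker_eq_range (hN : Module.Injective (PathAlgebra K V) N)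
    {i : PathAlgebra K V →ₗ[PathAlgebra K V] N} (hi : Function.Injective i)
    {P : Type*} [AddCommGroup P] [Module (PathAlgebra K V) P]
    (d : N →ₗ[PathAlgebra K V] P) (hd : ∀ x, d x = 0 ↔ ∃ y, i y = x) {a b : V} (β : a ⟶ b) :
    ¬ Module.Projective (PathAlgebra K V) P := by
  intro hP
  obtain ⟨y, hy⟩ := exists_arrow_smul_eq hN β (z := i (vertex K b))
    (by rw [← map_smul, smul_eq_mul, vertex_mul_vertex])
  have h0 : arrow K β • d y = 0 := by
    rw [← map_smul, hy]
    exact (hd _).2 ⟨_, rfl⟩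
  -- If `P` were projective, `e_a y` would lie in the image of `A`, giving `w` with `β w = e_b`; but
  -- every path occurring in `β w` ends with `β`, so it is not trivial.
  have h1 := vertex_smul_eq_zero_of_arrow_smul_eq_zero hP β h0
  rw [← map_smul, hd] at h1
  obtain ⟨w, hw⟩ := h1
  have h2 : arrow K β * w = vertex K b := by
    refine hi ?_
    rw [← smul_eq_mul, map_smul, hw, ← mul_smul, arrow_mul_vertex, hy]
  have h3 := coeff_ofPath_self (K := K) (⟨b, b, Quiver.Path.nil⟩ : QuiverPath V)
  rw [← vertex, ← h2, coeff_arrow_mul_of_forall_ne] at h3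
  · exact zero_ne_one h3
  · intro c q h
    have := congrArg (fun r : QuiverPath V => r.2.2.length) h
    simp at this

end Injective

end PathAlgebra

end

/-! ### Lower and upper bounds from an injective resolution -/

section

open CategoryTheory

universe u uK uV w

theorem CategoryTheory.InjectiveResolution.exists_linearMap {A : Type u} [Ring A]
    {M : Type u} [AddCommGroup M] [Module A M] (I : InjectiveResolution (ModuleCat.of A M)) :
    ∃ i : M →ₗ[A] I.cocomplex.X 0, Function.Injective i ∧
      ∀ x, (I.cocomplex.d 0 1).hom x = 0 ↔ ∃ y, i y = x := by
  let s := HomologicalComplex.singleObjXSelf (ComplexShape.up ℕ) 0 (ModuleCat.of A M)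
  refine ⟨(s.inv ≫ I.ι.f 0).hom, ?_, fun x => ⟨fun hx => ?_, ?_⟩⟩
  · have : Mono (s.inv ≫ I.ι.f 0) := mono_comp _ _
    exact (ModuleCat.mono_iff_injective _).1 this
  · obtain ⟨y, hy⟩ := (ShortComplex.moduleCat_exact_iff _).1 I.exact₀ x hx
    refine ⟨s.hom y, ?_⟩
    rw [← hy]
    exact congrArg (fun f => (ModuleCat.Hom.hom f) y) (s.hom_inv_id_assoc (I.ι.f 0))
  · rintro ⟨y, rfl⟩
    have h : (s.inv ≫ I.ι.f 0) ≫ I.cocomplex.d 0 1 = 0 := by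
      rw [Category.assoc, I.ι_f_zero_comp_complex_d, Limits.comp_zero]
    exact congrArg (fun f => (ModuleCat.Hom.hom f) y) h

/-- For `n = 0` no minimal injective resolution has to be exhibited: the supremum over the empty set
is already `0`. -/
theorem moduleDominantDimension_eq {A : Type u} [Ring A] {M : ModuleCat.{u} A} {n : ℕ}
    (h : n = 0 ∨ DominantDimensionGE M n) (h' : ∀ m, n < m → ¬ DominantDimensionGE M m) :
    moduleDominantDimension M = n := by
  refine le_antisymm (iSup₂_le fun m hm => ?_) ?_
  · exact Nat.cast_le.2 (not_lt.1 fun hlt => h' m hlt hm)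
  · rcases h with rfl | h
    · exact zero_le
    · exact le_iSup₂ (f := fun (m : ℕ) (_ : DominantDimensionGE M m) => (m : ℕ∞)) n h

namespace PathAlgebra

variable {K : Type uK} {V : Type uV} [Field K] [Quiver.{w} V] [Fintype V]

theorem subsingleton_arrows_of_dominantDimensionGE {n : ℕ} (hn : 0 < n)
    (h : DominantDimensionGE (ModuleCat.of (PathAlgebra K V) (PathAlgebra K V)) n) :
    (∀ a : V, Subsingleton (Σ b : V, a ⟶ b)) ∧ (∀ b : V, Subsingleton (Σ a : V, a ⟶ b)) := by
  obtain ⟨I, -, hP⟩ := h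
  obtain ⟨i, hi, -⟩ := I.exists_linearMap
  have hN : Module.Injective (PathAlgebra K V) (I.cocomplex.X 0) :=
    (Module.injective_iff_injective_object _ _).2 (I.injective 0)
  have hP0 : Module.Projective (PathAlgebra K V) (I.cocomplex.X 0) :=
    (IsProjective.iff_projective _).2 (hP 0 hn)
  exact ⟨fun a => ⟨fun x y => arrow_eq_of_source_eq hN hi hP0 x.2 y.2⟩,
    fun b => ⟨fun x y => arrow_eq_of_target_eq hN hi hP0 x.2 y.2⟩⟩

theorem not_dominantDimensionGE {a b : V} (β : a ⟶ b) {n : ℕ} (hn : 1 < n) :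
    ¬ DominantDimensionGE (ModuleCat.of (PathAlgebra K V) (PathAlgebra K V)) n := by
  rintro ⟨I, -, hP⟩
  obtain ⟨i, hi, hd⟩ := I.exists_linearMap
  have hN : Module.Injective (PathAlgebra K V) (I.cocomplex.X 0) :=
    (Module.injective_iff_injective_object _ _).2 (I.injective 0)
  exact not_projective_of_ker_eq_range hN hi _ hd β ((IsProjective.iff_projective _).2 (hP 1 hn))

end PathAlgebra

end

/-! ### Recognising linear quivers -/

section

variable {V : Type*} [Quiver V]

theorem QuiverAcyclic.eq_of_path (hacyc : QuiverAcyclic V) {a b : V} (p : Quiver.Path a b)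
    (q : Quiver.Path b a) : a = b := by
  have h := hacyc a (p.comp q)
  rw [Quiver.Path.length_comp] at h
  exact p.eq_of_length_zero (by lia)

theorem Quiver.Path.exists_arrow_of_ne {a b : V} (p : Quiver.Path a b) (h : a ≠ b) :
    ∃ (c : V) (_ : a ⟶ c), Nonempty (Quiver.Path c b) := by
  obtain ⟨c, e, q, -⟩ := p.length_ne_zero_iff_eq_comp.1 fun h0 => h (p.eq_of_length_zero h0)
  exact ⟨c, e, ⟨q⟩⟩

/-- Induction on an undirected walk. When a new arrow leaves or enters the current vertex alongside
the path already found, uniqueness of arrows forces it to be the adjacent step of that path, which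
is then shortened. -/
theorem path_total_of_subsingleton_arrows (hconn : QuiverConnected V)
    (hout : ∀ a : V, Subsingleton (Σ b : V, a ⟶ b))
    (hin : ∀ b : V, Subsingleton (Σ a : V, a ⟶ b)) (a b : V) :
    Nonempty (Quiver.Path a b) ∨ Nonempty (Quiver.Path b a) := by
  obtain ⟨p⟩ := hconn.2 a b
  induction p with
  | nil => exact Or.inl ⟨Quiver.Path.nil⟩
  | @cons b c p e ih =>
    change (b ⟶ c : Type _) ⊕ (c ⟶ b : Type _) at e
    rcases e with e | e
    · rcases ih with ⟨⟨q⟩⟩ | ⟨⟨q⟩⟩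
      · exact Or.inl ⟨q.cons e⟩
      · by_cases hba : (b : V) = a
        · subst hba
          exact Or.inl ⟨e.toPath⟩
        · obtain ⟨x, f, ⟨r⟩⟩ := q.exists_arrow_of_ne hba
          have := (hout b).elim ⟨c, e⟩ ⟨x, f⟩
          cases this
          exact Or.inr ⟨r⟩
    · rcases ih with ⟨⟨q⟩⟩ | ⟨⟨q⟩⟩
      · cases q with
        | nil => exact Or.inr ⟨e.toPath⟩
        | @cons x _ q f =>
          have := (hin b).elim ⟨c, e⟩ ⟨x, f⟩
          cases this
          exact Or.inl ⟨q⟩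
      · exact Or.inr ⟨e.toPath.comp q⟩

/-- Existence of a path is a linear order: antisymmetric by acyclicity, total by the preceding
lemma. Arrows are exactly its covering relations, and a finite linear order is some `Fin n`. -/
theorem exists_quiverIso_linearQuiver [Fintype V] (hconn : QuiverConnected V)
    (hacyc : QuiverAcyclic V) (hout : ∀ a : V, Subsingleton (Σ b : V, a ⟶ b))
    (hin : ∀ b : V, Subsingleton (Σ a : V, a ⟶ b)) :
    ∃ n : ℕ, 1 ≤ n ∧ Nonempty (QuiverIso V (LinearQuiver n)) := by
  classical
  let _ : LinearOrder V :=
    { le := fun a b => Nonempty (Quiver.Path a b)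
      le_refl := fun a => ⟨Quiver.Path.nil⟩
      le_trans := fun a b c ⟨p⟩ ⟨q⟩ => ⟨p.comp q⟩
      le_antisymm := fun a b ⟨p⟩ ⟨q⟩ => hacyc.eq_of_path p q
      le_total := path_total_of_subsingleton_arrows hconn hout hin
      toDecidableLE := Classical.decRel _ }
  have hcov : ∀ a b : V, Nonempty (a ⟶ b) ↔ a ⋖ b := by
    intro a b
    constructor
    · rintro ⟨e⟩
      have hne : a ≠ b := by
        rintro rfl
        have := hacyc a e.toPath
        simp at this
      refine ⟨lt_of_le_of_ne ⟨e.toPath⟩ hne, fun c hac hcb => ?_⟩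
      -- The first step of a path from `a` to `c` must be the unique arrow `e` out of `a`, so `b ≤
      -- c`.
      obtain ⟨p⟩ := hac.le
      obtain ⟨x, f, hx⟩ := p.exists_arrow_of_ne hac.ne
      have := (hout a).elim ⟨b, e⟩ ⟨x, f⟩
      cases this
      exact hcb.not_ge hx
    · intro h
      obtain ⟨p⟩ := h.le
      obtain ⟨x, f, hx⟩ := p.exists_arrow_of_ne h.ne
      have hne : a ≠ x := by
        rintro rfl
        have := hacyc a f.toPath
        simp at this
      have hax : a < x := lt_of_le_of_ne ⟨f.toPath⟩ hne
      obtain rfl : x = b := eq_of_le_of_not_lt hx (h.2 hax)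
      exact ⟨f⟩
  let f : V ≃o Fin (Fintype.card V) := (Fintype.orderIsoFinOfCardEq V rfl).symm
  have := hconn.1
  have hsucc : ∀ a b : V, Nonempty (a ⟶ b) ↔ (f a).val + 1 = (f b).val := by
    intro a b
    rw [hcov, ← apply_covBy_apply_iff f, Fin.covBy_iff, Order.covBy_iff_add_one_eq]
  refine ⟨Fintype.card V, Fintype.card_pos, ⟨⟨f.toEquiv, fun a b => ?_⟩⟩⟩
  exact
    { toFun := fun e => ⟨(hsucc a b).1 ⟨e⟩⟩
      invFun := fun e => ((hsucc a b).2 e.down).some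
      left_inv := fun e => by
        have := (hout a).elim ⟨b, ((hsucc a b).2 ((hsucc a b).1 ⟨e⟩)).some⟩ ⟨b, e⟩
        exact eq_of_heq (Sigma.mk.inj this).2
      right_inv := fun e => rfl }

end

/-! ### The thin module -/

section

/-- Baer's criterion for modules which are dual to a right ideal generated by an idempotent `e`. -/
theorem Module.Baer.of_pairing {K A N : Type*} [Field K] [Ring A] [Algebra K A] [AddCommGroup N]
    [Module K N] [Module A N] [IsScalarTower K A N] (φ : N →ₗ[K] K) (e : A)
    (hnd : ∀ x : N, (∀ u : A, φ ((e * u) • x) = 0) → x = 0)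
    (hsurj : ∀ G : A →ₗ[K] K, ∃ x : N, ∀ u : A, φ ((e * u) • x) = G (e * u)) :
    Module.Baer A N := by
  intro I g
  -- The functional `φ ∘ g` on the ideal extends over the field to all of `A`; the element `x`
  -- representing it is the required image of `1`, since `g m` and `m • x` have the same pairings
  -- with `e A`.
  obtain ⟨G, hG⟩ := LinearMap.exists_extend (p := I.restrictScalars K) (φ ∘ₗ g.restrictScalars K)
  obtain ⟨x, hx⟩ := hsurj G
  refine ⟨LinearMap.toSpanSingleton A N x, fun m hm => ?_⟩
  rw [LinearMap.toSpanSingleton_apply, ← sub_eq_zero]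
  refine hnd _ fun u => ?_
  have h1 : φ (g ⟨(e * u) * m, I.mul_mem_left _ hm⟩) = G ((e * u) * m) :=
    (LinearMap.congr_fun hG ⟨(e * u) * m, I.mul_mem_left _ hm⟩).symm
  have h2 : g ⟨(e * u) * m, I.mul_mem_left _ hm⟩ = (e * u) • g ⟨m, hm⟩ :=
    map_smul g (e * u) ⟨m, hm⟩
  rw [smul_sub, map_sub, ← h2, h1, ← mul_smul, mul_assoc, hx, sub_self]

theorem Module.Baer.pi {A ι : Type*} [Ring A] {N : ι → Type*} [∀ i, AddCommGroup (N i)]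
    [∀ i, Module A (N i)] (h : ∀ i, Module.Baer A (N i)) : Module.Baer A (∀ i, N i) := by
  intro I g
  choose l hl using fun i => h i I (LinearMap.proj i ∘ₗ g)
  exact ⟨LinearMap.pi l, fun x hx => funext fun i => hl i x hx⟩

open Classical in
/-- The linear map by which a path acts on the thin representation. -/
noncomputable def thinEnd (K : Type*) {V : Type*} [Field K] [Quiver V] (p : QuiverPath V) :
    Module.End K (V → K) :=
  LinearMap.single K (fun _ => K) p.2.1 ∘ₗ LinearMap.proj p.1

open Classical in
theorem thinEnd_apply {K V : Type*} [Field K] [Quiver V] (p : QuiverPath V) (f : V → K) :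
    thinEnd K p f = Pi.single p.2.1 (f p.1) :=
  rfl

/-- The representation with the field at each vertex in which each arrow acts by the identity. It
is considered only for quivers with at most one path between any two vertices. -/
def ThinModule (K V : Type*) : Type _ := V → K

namespace ThinModule

open PathAlgebra

variable {K : Type*} {V : Type*} [Field K]

noncomputable instance : AddCommGroup (ThinModule K V) := inferInstanceAs (AddCommGroup (V → K))

noncomputable instance : Module K (ThinModule K V) := inferInstanceAs (Module K (V → K))

theorem add_apply (f g : ThinModule K V) (i : V) : (f + g) i = f i + g i := rfl

theorem smul_apply (c : K) (f : ThinModule K V) (i : V) : (c • f) i = c * f i := rfl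

theorem zero_apply (i : V) : (0 : ThinModule K V) i = 0 := rfl

/-- Evaluation at a vertex. -/
noncomputable def eval (K : Type*) {V : Type*} [Field K] (b : V) : ThinModule K V →ₗ[K] K :=
  (LinearMap.proj b : (V → K) →ₗ[K] K)

theorem eval_apply (b : V) (f : ThinModule K V) : eval K b f = f b := rfl

variable [Quiver V]

/-- The action of the path algebra on the thin module, as a linear map. -/
noncomputable def actionLinear : PathAlgebra K V →ₗ[K] Module.End K (V → K) :=
  Finsupp.linearCombination K (thinEnd K)

theorem actionLinear_ofPath (p : QuiverPath V) :
    actionLinear (ofPath p) = thinEnd K p :=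
  (Finsupp.linearCombination_single K (1 : K) p).trans (one_smul K _)

variable [Fintype V]

theorem actionLinear_one : actionLinear (1 : PathAlgebra K V) = 1 := by
  classical
  rw [one_def, map_sum]
  refine LinearMap.ext fun f => funext fun i => ?_
  simp only [actionLinear_ofPath, LinearMap.sum_apply, thinEnd_apply, Finset.sum_apply]
  simp [Pi.single_apply]

theorem actionLinear_mul (x y : PathAlgebra K V) :
    actionLinear (x * y) = actionLinear x * actionLinear y := by
  classical
  induction x using induction_linear with
  | h0 => rw [zero_mul, map_zero, zero_mul]
  | hadd x x' hx hx' => rw [add_mul, map_add, map_add, add_mul, hx, hx']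
  | hsmul c p =>
    induction y using induction_linear with
    | h0 => rw [mul_zero, map_zero, mul_zero]
    | hadd y y' hy hy' => rw [mul_add, map_add, map_add, mul_add, hy, hy']
    | hsmul d q =>
      rw [smul_mul_smul_comm, map_smul, map_smul, map_smul, smul_mul_smul_comm,
        actionLinear_ofPath, actionLinear_ofPath, ofPath_mul_ofPath]
      congr 1
      obtain ⟨b', c, p⟩ := p
      obtain ⟨a, b, q⟩ := q
      refine LinearMap.ext fun f => ?_
      rw [Module.End.mul_apply, thinEnd_apply, thinEnd_apply]
      by_cases h : b = b'
      · subst h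
        rw [pathMul_comp, actionLinear_ofPath, thinEnd_apply]
        simp
      · rw [pathMul_ne h, map_zero]
        simp [Ne.symm h]

/-- The action of the path algebra on the thin module. -/
noncomputable def action : PathAlgebra K V →ₐ[K] Module.End K (V → K) :=
  AlgHom.ofLinearMap actionLinear actionLinear_one actionLinear_mul

noncomputable instance : Module (PathAlgebra K V) (ThinModule K V) :=
  Module.compHom (V → K) (action (K := K) (V := V)).toRingHom

theorem smul_def (x : PathAlgebra K V) (f : ThinModule K V) :
    x • f = actionLinear x (f : V → K) :=
  rfl

instance : IsScalarTower K (PathAlgebra K V) (ThinModule K V) where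
  smul_assoc c x f := by
    rw [smul_def, map_smul]
    rfl

open Classical in
theorem ofPath_smul (p : QuiverPath V) (f : ThinModule K V) :
    (ofPath p : PathAlgebra K V) • f = (Pi.single p.2.1 (f p.1) : V → K) := by
  rw [smul_def, actionLinear_ofPath]
  rfl

theorem ofPath_smul_apply_target {a b : V} (p : Quiver.Path a b) (f : ThinModule K V) :
    ((ofPath ⟨a, b, p⟩ : PathAlgebra K V) • f) b = f a := by
  classical
  rw [ofPath_smul]
  exact Pi.single_eq_same _ _

theorem ofPath_smul_apply_of_ne {a b c : V} (p : Quiver.Path a b) (f : ThinModule K V)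
    (h : c ≠ b) : ((ofPath ⟨a, b, p⟩ : PathAlgebra K V) • f) c = 0 := by
  classical
  rw [ofPath_smul]
  exact Pi.single_eq_of_ne h _

/-- The submodule of elements vanishing on all predecessors of a set of vertices. -/
noncomputable def vanishing (K : Type*) {V : Type*} [Field K] [Quiver V] [Fintype V]
    (S : Set V) : Submodule (PathAlgebra K V) (ThinModule K V) where
  carrier := {f | ∀ i ∈ S, ∀ j, Nonempty (Quiver.Path j i) → f j = 0}
  zero_mem' _ _ _ _ := rfl
  add_mem' {f g} hf hg i hi j hj := by rw [add_apply, hf i hi j hj, hg i hi j hj, add_zero]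
  smul_mem' x f hf := by
    induction x using induction_linear with
    | h0 => intro i hi j hj; rw [zero_smul, zero_apply]
    | hadd x y hx hy =>
      intro i hi j hj
      rw [add_smul, add_apply, hx i hi j hj, hy i hi j hj, add_zero]
    | hsmul c p =>
      intro i hi j ⟨q⟩
      rw [smul_assoc, smul_apply]
      obtain ⟨a, b, p⟩ := p
      by_cases h : j = b
      · subst h
        rw [ofPath_smul_apply_target, hf i hi a ⟨p.comp q⟩, mul_zero]
      · rw [ofPath_smul_apply_of_ne _ _ h, mul_zero]

theorem mem_vanishing {S : Set V} {f : ThinModule K V} :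
    f ∈ vanishing K S ↔ ∀ i ∈ S, ∀ j, Nonempty (Quiver.Path j i) → f j = 0 :=
  Iff.rfl

/-- The quotient of the thin module which is supported on the predecessors of a vertex is
injective. -/
theorem baer_quotient_vanishing_singleton (hsub : ∀ a b : V, Subsingleton (Quiver.Path a b))
    (b : V) : Module.Baer (PathAlgebra K V) (ThinModule K V ⧸ vanishing K {b}) := by
  classical
  -- Evaluation at `b`, through which the quotient becomes the dual of `e_b A`, the span of the
  -- paths ending at `b`.
  let φ : (ThinModule K V ⧸ vanishing K {b}) →ₗ[K] K :=
    ((vanishing K {b}).restrictScalars K).liftQ (eval K b)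
      (fun f hf => hf b rfl b ⟨Quiver.Path.nil⟩) ∘ₗ
      (Submodule.Quotient.restrictScalarsEquiv K (vanishing K {b})).symm.toLinearMap
  have hφ : ∀ f : ThinModule K V, φ (Submodule.Quotient.mk f) = f b := fun f => rfl
  refine Module.Baer.of_pairing φ (vertex K b) (fun x hx => ?_) fun G => ?_
  · obtain ⟨f, rfl⟩ := Submodule.Quotient.mk_surjective _ x
    rw [Submodule.Quotient.mk_eq_zero, mem_vanishing]
    rintro i rfl j ⟨p⟩
    have := hx (ofPath ⟨j, i, p⟩)
    rw [vertex, ofPath_mul_comp, Quiver.Path.comp_nil, ← Submodule.Quotient.mk_smul, hφ,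
      ofPath_smul_apply_target] at this
    exact this
  · let f : ThinModule K V := fun i =>
      if h : Nonempty (Quiver.Path i b) then G (ofPath ⟨i, b, h.some⟩) else 0
    refine ⟨Submodule.Quotient.mk f, fun u => ?_⟩
    rw [← Submodule.Quotient.mk_smul, hφ]
    induction u using induction_linear with
    | h0 => rw [mul_zero, zero_smul, map_zero, zero_apply]
    | hadd x y hx hy => rw [mul_add, add_smul, map_add, add_apply, hx, hy]
    | hsmul c p =>
      rw [mul_smul_comm, smul_assoc, map_smul, smul_apply, smul_eq_mul]
      congr 1
      obtain ⟨i, j, p⟩ := p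
      rw [vertex, ofPath_mul_ofPath]
      by_cases h : j = b
      · subst h
        rw [pathMul_comp, ofPath_smul_apply_target, Quiver.Path.comp_nil]
        have hne : Nonempty (Quiver.Path i j) := ⟨p⟩
        simp only [f, dif_pos hne]
        rw [(hsub i j).elim hne.some p]
      · rw [pathMul_ne h, zero_smul, map_zero, zero_apply]

open Classical in
/-- The thin module is a direct summand of the path algebra if there is exactly one path from a
given vertex to each vertex. -/
theorem projective (s : V) (hs : ∀ b, Nonempty (Quiver.Path s b))
    (hsub : ∀ a b : V, Subsingleton (Quiver.Path a b)) :
    Module.Projective (PathAlgebra K V) (ThinModule K V) := by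
  let q : ∀ b : V, Quiver.Path s b := fun b => (hs b).some
  -- The basis vector at `b` goes to the path from `s` to `b`, identifying the thin module with `A
  -- e_s`. The retraction is `x ↦ x • δ`, with `δ` the basis vector at `s`.
  let j : ThinModule K V →ₗ[K] PathAlgebra K V :=
    ∑ b : V, (eval K b).smulRight (ofPath ⟨s, b, q b⟩)
  have hj : ∀ f, j f = ∑ b : V, f b • ofPath ⟨s, b, q b⟩ := fun f => by
    simp only [j, LinearMap.sum_apply, LinearMap.smulRight_apply, eval_apply]
  have hsmul : ∀ (x : PathAlgebra K V) (f : ThinModule K V), j (x • f) = x • j f := by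
    intro x f
    induction x using induction_linear with
    | h0 => rw [zero_smul, zero_smul, map_zero]
    | hadd x y hx hy => rw [add_smul, add_smul, map_add, hx, hy]
    | hsmul c p =>
      rw [smul_assoc, smul_assoc, map_smul]
      congr 1
      obtain ⟨a, b, p⟩ := p
      rw [hj, hj, smul_eq_mul, Finset.mul_sum, Finset.sum_eq_single b, Finset.sum_eq_single a]
      · rw [ofPath_smul_apply_target, mul_smul_comm, ofPath_mul_comp,
          (hsub s b).elim ((q a).comp p) (q b)]
      · intro c _ hc
        rw [mul_smul_comm, ofPath_mul_ofPath, pathMul_ne hc, smul_zero]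
      · exact fun h => absurd (Finset.mem_univ _) h
      · intro c _ hc
        rw [ofPath_smul_apply_of_ne _ _ hc, zero_smul]
      · exact fun h => absurd (Finset.mem_univ _) h
  let δ : ThinModule K V := (Pi.single s 1 : V → K)
  refine Module.Projective.of_split (R := PathAlgebra K V) (M := PathAlgebra K V)
    { j with map_smul' := hsmul } (LinearMap.toSpanSingleton (PathAlgebra K V) _ δ) ?_
  refine LinearMap.ext fun f => ?_
  change j f • δ = f
  have hδ : δ s = 1 := Pi.single_eq_same (M := fun _ => K) s 1
  rw [hj, Finset.sum_smul]
  refine funext fun i => ?_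
  have hev := map_sum (eval K i)
    (fun b => (f b • ofPath ⟨s, b, q b⟩ : PathAlgebra K V) • δ) Finset.univ
  rw [eval_apply] at hev
  rw [hev, Finset.sum_eq_single i]
  · rw [eval_apply, smul_assoc, smul_apply, ofPath_smul_apply_target, hδ, mul_one]
  · intro b _ hb
    rw [eval_apply, smul_assoc, smul_apply, ofPath_smul_apply_of_ne _ _ (Ne.symm hb), mul_zero]
  · exact fun h => absurd (Finset.mem_univ _) h

end ThinModule

end

/-! ### Dominant dimension of linear quivers -/

section

open CategoryTheory

universe u v uK uV w

/-! ### Two-term injective resolutions. -/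

section Resolution

variable {A : Type u} [Ring A] {M I₀ I₁ : Type u} [AddCommGroup M] [Module A M]
  [AddCommGroup I₀] [Module A I₀] [AddCommGroup I₁] [Module A I₁]

/-- The objects of the complex `I₀ ⟶ I₁ ⟶ 0 ⟶ ⋯`. -/
noncomputable def twoTermX (A : Type u) [Ring A] (I₀ I₁ : Type u) [AddCommGroup I₀] [Module A I₀]
    [AddCommGroup I₁] [Module A I₁] : ℕ → ModuleCat.{u} A
  | 0 => ModuleCat.of A I₀
  | 1 => ModuleCat.of A I₁
  | _ + 2 => ModuleCat.of A PUnit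

/-- The differentials of the complex `I₀ ⟶ I₁ ⟶ 0 ⟶ ⋯`. -/
noncomputable def twoTermD (d : I₀ →ₗ[A] I₁) :
    ∀ n, twoTermX A I₀ I₁ n ⟶ twoTermX A I₀ I₁ (n + 1)
  | 0 => ModuleCat.ofHom d
  | _ + 1 => 0

/-- The complex `I₀ ⟶ I₁ ⟶ 0 ⟶ ⋯`. -/
noncomputable def twoTermComplex (d : I₀ →ₗ[A] I₁) : CochainComplex (ModuleCat.{u} A) ℕ :=
  CochainComplex.of (twoTermX A I₀ I₁) (twoTermD d) fun n => by
    cases n <;> exact Limits.comp_zero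

theorem twoTermComplex_d (d : I₀ →ₗ[A] I₁) (n : ℕ) :
    (twoTermComplex d).d n (n + 1) = twoTermD d n :=
  CochainComplex.of_d _ _ _

theorem twoTermComplex_exactAt_succ {d : I₀ →ₗ[A] I₁} (hd : Function.Surjective d) (n : ℕ) :
    (twoTermComplex d).ExactAt (n + 1) := by
  rw [HomologicalComplex.exactAt_iff' _ n (n + 1) (n + 1 + 1) (by simp) (by simp),
    ShortComplex.moduleCat_exact_iff]
  intro x _
  change ∃ y, (twoTermComplex d).d n (n + 1) y = x
  rw [twoTermComplex_d]
  cases n with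
  | zero => exact hd x
  | succ n => exact ⟨0, Subsingleton.elim (α := PUnit) _ _⟩

/-- An injective copresentation with surjective second map, as an injective resolution. -/
noncomputable def twoTermResolution (i : M →ₗ[A] I₀) (d : I₀ →ₗ[A] I₁)
    (hi : Function.Injective i) (hid : ∀ x, d x = 0 ↔ ∃ y, i y = x) (hd : Function.Surjective d)
    (h₀ : Module.Injective A I₀) (h₁ : Module.Injective A I₁) :
    InjectiveResolution (ModuleCat.of A M) where
  cocomplex := twoTermComplex d
  injective
    | 0 => (Module.injective_iff_injective_object A I₀).1 h₀
    | 1 => (Module.injective_iff_injective_object A I₁).1 h₁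
    | _ + 2 => (Module.injective_iff_injective_object A PUnit).1
        ⟨fun _ _ _ _ _ _ _ _ _ => ⟨0, fun _ => rfl⟩⟩
  ι := (CochainComplex.fromSingle₀Equiv (twoTermComplex d) (ModuleCat.of A M)).symm
    ⟨ModuleCat.ofHom i, by
      rw [twoTermComplex_d]
      exact ModuleCat.hom_ext (LinearMap.ext fun y => (hid _).2 ⟨y, rfl⟩)⟩
  quasiIso := ⟨fun n => by
    cases n with
    | zero =>
      -- In degree zero, being a quasi-isomorphism amounts to exactness of `M ⟶ I₀ ⟶ I₁` together
      -- with injectivity of the first map.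
      rw [CochainComplex.quasiIsoAt₀_iff, ShortComplex.quasiIso_iff_of_zeros]
      · have hS : (ShortComplex.mk (ModuleCat.ofHom i) (ModuleCat.ofHom d)
            (ModuleCat.hom_ext (LinearMap.ext fun y => (hid _).2 ⟨y, rfl⟩))).Exact :=
          (ShortComplex.moduleCat_exact_iff _).2 fun x hx => (hid x).1 hx
        have : Mono (ModuleCat.ofHom i) := (ModuleCat.mono_iff_injective _).2 hi
        refine (ShortComplex.exact_and_mono_f_iff_of_iso ?_).2 ⟨hS, this⟩
        exact ShortComplex.isoMk (Iso.refl _) (Iso.refl _) (Iso.refl _)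
          ((Category.id_comp _).trans ((CochainComplex.fromSingle₀Equiv_symm_apply_f_zero
            (C := twoTermComplex d) _ _).symm.trans (Category.comp_id _).symm))
          ((Category.id_comp _).trans ((twoTermComplex_d d 0).symm.trans
            (Category.comp_id _).symm))
      all_goals rfl
    | succ n =>
      rw [quasiIsoAt_iff_exactAt]
      · exact twoTermComplex_exactAt_succ hd n
      · apply CochainComplex.exactAt_succ_single_obj⟩

theorem dominantDimensionGE_one_of_exact (i : M →ₗ[A] I₀) (d : I₀ →ₗ[A] I₁)
    (hi : Function.Injective i) (hid : ∀ x, d x = 0 ↔ ∃ y, i y = x) (hd : Function.Surjective d)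
    (h₀ : Module.Injective A I₀) (h₁ : Module.Injective A I₁) (hP : Module.Projective A I₀)
    (hess : ∀ x : I₀, x ≠ 0 → ∃ a : A, a • x ≠ 0 ∧ d (a • x) = 0) :
    DominantDimensionGE (ModuleCat.of A M) 1 := by
  refine ⟨twoTermResolution i d hi hid hd h₀ h₁, fun j L hL => ?_, fun j hj => ?_⟩
  · change L ⊓ LinearMap.ker ((twoTermComplex d).d j (j + 1)).hom = ⊥ at hL
    rw [twoTermComplex_d] at hL
    cases j with
    | zero =>
      refine (Submodule.eq_bot_iff _).2 fun x hx => ?_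
      by_contra hne
      obtain ⟨a, ha, ha'⟩ := hess x hne
      exact ha ((Submodule.eq_bot_iff _).1 hL (a • x) ⟨L.smul_mem a hx, ha'⟩)
    -- From degree one on the differential is zero, so its kernel is everything and essentiality is
    -- automatic.
    | succ j =>
      refine (Submodule.eq_bot_iff _).2 fun x hx => ?_
      exact (Submodule.eq_bot_iff _).1 hL x ⟨hx, rfl⟩
  · obtain rfl : j = 0 := by lia
    exact (IsProjective.iff_projective I₀).1 hP

end Resolution

/-- The type of arrows may live in a larger universe than the field and the vertices, so the thin
modules must be lifted to the universe of the path algebra. Baer's condition, unlike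
`Module.Injective`, does not depend on the universe of test modules. -/
theorem dominantDimensionGE_one_of_baer {A : Type (max u v)} [Ring A] {M : Type (max u v)}
    {I₀ I₁ : Type v} [AddCommGroup M] [Module A M] [AddCommGroup I₀] [Module A I₀]
    [AddCommGroup I₁] [Module A I₁] (i : M →ₗ[A] I₀) (d : I₀ →ₗ[A] I₁)
    (hi : Function.Injective i) (hid : ∀ x, d x = 0 ↔ ∃ y, i y = x) (hd : Function.Surjective d)
    (h₀ : Module.Baer A I₀) (h₁ : Module.Baer A I₁) (hP : Module.Projective A I₀)
    (hess : ∀ x : I₀, x ≠ 0 → ∃ a : A, a • x ≠ 0 ∧ d (a • x) = 0) :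
    DominantDimensionGE (ModuleCat.of A M) 1 := by
  let e₀ : ULift.{u} I₀ ≃ₗ[A] I₀ := ULift.moduleEquiv
  let e₁ : ULift.{u} I₁ ≃ₗ[A] I₁ := ULift.moduleEquiv
  refine dominantDimensionGE_one_of_exact (e₀.symm.toLinearMap ∘ₗ i)
    (e₁.symm.toLinearMap ∘ₗ d ∘ₗ e₀.toLinearMap) (e₀.symm.injective.comp hi) (fun x => ?_)
    (e₁.symm.surjective.comp (hd.comp e₀.surjective)) (Module.Baer.of_equiv e₀.symm h₀).injective
    (Module.Baer.of_equiv e₁.symm h₁).injective inferInstance fun x hx => ?_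
  · refine (e₁.symm.map_eq_zero_iff).trans ((hid (e₀ x)).trans (exists_congr fun y => ?_))
    exact (e₀.symm_apply_eq).symm
  · obtain ⟨a, ha, ha'⟩ := hess (e₀ x) (fun h => hx (e₀.map_eq_zero_iff.1 h))
    rw [← map_smul] at ha ha'
    exact ⟨a, fun h => ha (e₀.map_eq_zero_iff.2 h), e₁.symm.map_eq_zero_iff.2 ha'⟩

end

/-! ### The path algebra as triangular matrices. -/

section

universe uK uV w

namespace ThinModule

open PathAlgebra

variable {K : Type uK} {V : Type uV} [Field K]

/-- The standard basis vector at a vertex. -/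
noncomputable def basisVec (K : Type*) {V : Type*} [Field K] (a : V) : ThinModule K V :=
  open Classical in (Pi.single a 1 : V → K)

theorem basisVec_self (a : V) : basisVec K a a = 1 := by
  classical
  exact Pi.single_eq_same (M := fun _ => K) a 1

theorem basisVec_of_ne {a b : V} (h : b ≠ a) : basisVec K a b = 0 := by
  classical
  exact Pi.single_eq_of_ne (M := fun _ => K) h 1

variable [Quiver.{w} V] [Fintype V]

/-- The embedding of the path algebra into the square matrices, seen as a family of columns. -/
noncomputable def embedding (K : Type uK) (V : Type uV) [Field K] [Quiver.{w} V] [Fintype V] :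
    PathAlgebra K V →ₗ[PathAlgebra K V] (V → ThinModule K V) :=
  LinearMap.pi fun a => LinearMap.toSpanSingleton _ _ (basisVec K a)

theorem embedding_apply (x : PathAlgebra K V) (a : V) :
    embedding K V x a = x • basisVec K a :=
  rfl

/-- With unique paths, the matrix of `x` just records its coefficients; this yields injectivity of
the embedding. -/
theorem smul_basisVec_apply (hsub : ∀ a b : V, Subsingleton (Quiver.Path a b))
    (x : PathAlgebra K V) {a b : V} (p : Quiver.Path a b) :
    (x • basisVec K a) b = coeff ⟨a, b, p⟩ x := by
  induction x using induction_linear with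
  | h0 => rw [zero_smul, map_zero, zero_apply]
  | hadd x y hx hy => rw [add_smul, map_add, add_apply, hx, hy]
  | hsmul c q =>
    rw [smul_assoc, smul_apply, map_smul, smul_eq_mul]
    congr 1
    obtain ⟨a', b', q⟩ := q
    by_cases hb : b = b'
    · subst hb
      rw [ofPath_smul_apply_target]
      by_cases ha : a' = a
      · subst ha
        rw [basisVec_self, (hsub a' b).elim q p, coeff_ofPath_self]
      · rw [basisVec_of_ne ha, coeff_ofPath_of_ne]
        exact fun h => ha (congrArg (fun r : QuiverPath V => r.1) h)
    · rw [ofPath_smul_apply_of_ne _ _ hb, coeff_ofPath_of_ne]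
      exact fun h => hb (congrArg (fun r : QuiverPath V => r.2.1) h).symm

theorem smul_basisVec_apply_of_isEmpty (x : PathAlgebra K V) {a b : V}
    (h : IsEmpty (Quiver.Path a b)) : (x • basisVec K a) b = 0 := by
  induction x using induction_linear with
  | h0 => rw [zero_smul, zero_apply]
  | hadd x y hx hy => rw [add_smul, add_apply, hx, hy, add_zero]
  | hsmul c q =>
    rw [smul_assoc, smul_apply]
    obtain ⟨a', b', q⟩ := q
    by_cases hb : b = b'
    · subst hb
      have ha : a' ≠ a := by
        rintro rfl
        exact h.elim q
      rw [ofPath_smul_apply_target, basisVec_of_ne ha, mul_zero]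
    · rw [ofPath_smul_apply_of_ne _ _ hb, mul_zero]

theorem embedding_injective (hsub : ∀ a b : V, Subsingleton (Quiver.Path a b)) :
    Function.Injective (embedding K V) := by
  intro x y h
  refine ext_coeff fun ⟨a, b, p⟩ => ?_
  rw [← smul_basisVec_apply hsub, ← smul_basisVec_apply hsub, ← embedding_apply, h,
    embedding_apply]

/-- The image consists of all matrices supported on pairs joined by a path: each such entry is
realised by a multiple of that path. -/
theorem exists_embedding_eq (hsub : ∀ a b : V, Subsingleton (Quiver.Path a b))
    {F : V → ThinModule K V} (hF : ∀ a b, IsEmpty (Quiver.Path a b) → F a b = 0) :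
    ∃ x, embedding K V x = F := by
  classical
  let P : V → V → PathAlgebra K V := fun a b =>
    if h : Nonempty (Quiver.Path a b) then F a b • ofPath ⟨a, b, h.some⟩ else 0
  refine ⟨∑ a, ∑ b, P a b, funext fun a => funext fun b => ?_⟩
  rw [embedding_apply]
  by_cases h : Nonempty (Quiver.Path a b)
  · rw [smul_basisVec_apply hsub _ h.some, map_sum, Finset.sum_eq_single a, map_sum,
      Finset.sum_eq_single b]
    · simp only [P, dif_pos h]
      rw [map_smul, coeff_ofPath_self, smul_eq_mul, mul_one]
    · intro b' _ hb
      simp only [P]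
      split_ifs
      · rw [map_smul, coeff_ofPath_of_ne, smul_zero]
        exact fun h => hb (congrArg (fun r : QuiverPath V => r.2.1) h)
      · exact map_zero _
    · exact fun h => absurd (Finset.mem_univ _) h
    · intro a' _ ha
      rw [map_sum]
      refine Finset.sum_eq_zero fun b' _ => ?_
      simp only [P]
      split_ifs
      · rw [map_smul, coeff_ofPath_of_ne, smul_zero]
        exact fun h => ha (congrArg (fun r : QuiverPath V => r.1) h)
      · exact map_zero _
    · exact fun h => absurd (Finset.mem_univ _) h
  · rw [not_nonempty_iff] at h
    rw [smul_basisVec_apply_of_isEmpty _ h, hF a b h]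

/-- If the vertices are linearly ordered by the existence of a path, and paths are unique, then the
path algebra has dominant dimension at least one. -/
theorem dominantDimensionGE_one [LinearOrder V] [Nonempty V]
    (hle : ∀ a b : V, Nonempty (Quiver.Path a b) ↔ a ≤ b)
    (hsub : ∀ a b : V, Subsingleton (Quiver.Path a b)) :
    DominantDimensionGE (ModuleCat.of (PathAlgebra K V) (PathAlgebra K V)) 1 := by
  classical
  obtain ⟨s, hs⟩ := Finite.exists_min (id : V → V)
  obtain ⟨t, ht⟩ := Finite.exists_max (id : V → V)
  have hempty : ∀ a b : V, IsEmpty (Quiver.Path a b) ↔ b < a := fun a b => by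
    rw [← not_nonempty_iff, hle, not_le]
  have hproj := projective (K := K) s (fun b => (hle s b).2 (hs b)) hsub
  have hmem : ∀ (a : V) (f : ThinModule K V),
      f ∈ vanishing K (Set.Iio a) ↔ ∀ b, b < a → f b = 0 := by
    intro a f
    rw [mem_vanishing]
    exact ⟨fun h b hb => h b hb b ⟨Quiver.Path.nil⟩,
      fun h i hi j hj => h j (((hle j i).1 hj).trans_lt hi)⟩
  -- A non-empty lower set consists of the predecessors of its largest element `b`, so the quotient
  -- is dual to `e_b A`. The empty set, which occurs for the column of the least vertex, gives the
  -- zero module.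
  have hinj : ∀ S : Set V, IsLowerSet S → Module.Baer (PathAlgebra K V)
      (ThinModule K V ⧸ vanishing K S) := by
    intro S hS
    rcases S.eq_empty_or_nonempty with rfl | hne
    · have htop : vanishing K (∅ : Set V) = ⊤ :=
        Submodule.eq_top_iff'.2 fun f i hi => absurd hi (Set.notMem_empty i)
      have := Submodule.Quotient.subsingleton_iff.2 htop
      exact fun I g => ⟨0, fun x hx => Subsingleton.elim _ _⟩
    · obtain ⟨b, hb, hmax⟩ := S.toFinite.exists_maximalFor id S hne
      have hSb : vanishing K S = vanishing K {b} := by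
        refine le_antisymm (fun f hf i hi j hj => ?_) fun f hf i hi j hj => ?_
        · exact hf i ((Set.mem_singleton_iff.1 hi) ▸ hb) j hj
        · have hib : i ≤ b := (le_total i b).elim id fun h => hmax hi h
          exact hf b rfl j ((hle j b).2 (((hle j i).1 hj).trans hib))
      rw [hSb]
      exact baer_quotient_vanishing_singleton hsub b
  have hbot : vanishing K (Set.univ : Set V) = ⊥ :=
    (Submodule.eq_bot_iff _).2 fun f hf => funext fun i => hf i trivial i ⟨Quiver.Path.nil⟩
  have hC : Module.Baer (PathAlgebra K V) (ThinModule K V) :=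
    Module.Baer.of_equiv (Submodule.quotEquivOfEqBot _ hbot) (hinj _ isLowerSet_univ)
  -- In column `a` only the entries strictly before `a` are kept, so the kernel is the space of
  -- triangular matrices.
  let d : (V → ThinModule K V) →ₗ[PathAlgebra K V]
      (∀ a : V, ThinModule K V ⧸ vanishing K (Set.Iio a)) :=
    LinearMap.pi fun a => (vanishing K (Set.Iio a)).mkQ ∘ₗ LinearMap.proj a
  have hd : ∀ F : V → ThinModule K V, d F = 0 ↔ ∀ a b, b < a → F a b = 0 := by
    intro F
    rw [funext_iff]
    refine forall_congr' fun a => ?_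
    rw [← hmem]
    exact Submodule.Quotient.mk_eq_zero _
  refine dominantDimensionGE_one_of_baer.{max uK uV w, max uK uV} (embedding K V) d
    (embedding_injective hsub) (fun F => ?_) (fun G => ?_) (Module.Baer.pi fun _ => hC)
    (Module.Baer.pi fun a => hinj _ (isLowerSet_Iio a)) ?_ fun F hF => ?_
  · rw [hd]
    constructor
    · exact fun h => exists_embedding_eq hsub fun a b hab => h a b ((hempty a b).1 hab)
    · rintro ⟨x, rfl⟩ a b hab
      exact smul_basisVec_apply_of_isEmpty x ((hempty a b).2 hab)
  · choose F hF using fun a => Submodule.mkQ_surjective _ (G a)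
    exact ⟨F, funext hF⟩
  · exact Module.Projective.of_equiv' (DFinsupp.linearEquivFunOnFintype (R := PathAlgebra K V)
      (M := fun _ : V => ThinModule K V))
  -- A nonzero entry in row `i` is moved by the path from `i` to the sink `t`. The result lives in
  -- row `t` only, and `t` is never strictly before a column index, so `d` kills it.
  · obtain ⟨a, ha⟩ := Function.ne_iff.1 hF
    obtain ⟨i, hi⟩ := Function.ne_iff.1 ha
    obtain ⟨p⟩ := (hle i t).2 (ht i)
    refine ⟨ofPath ⟨i, t, p⟩, fun h => hi ?_, (hd _).2 fun c j hj => ?_⟩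
    · have := congrFun (congrFun h a) t
      rwa [Pi.smul_apply, ofPath_smul_apply_target] at this
    · rw [Pi.smul_apply, ofPath_smul_apply_of_ne]
      rintro rfl
      exact (ht c).not_gt hj

end ThinModule

end

/-! ### Paths in a linear quiver, via positions of vertices. -/

section

variable {V : Type*} [Quiver V] {n : ℕ}

namespace QuiverIso

variable (φ : QuiverIso V (LinearQuiver n))

/-- The position of a vertex in a linear quiver. -/
def position (a : V) : ℕ := Fin.val (φ.onVertices a)

theorem position_injective : Function.Injective φ.position :=
  Fin.val_injective.comp φ.onVertices.injective

theorem position_succ {a b : V} (e : a ⟶ b) : φ.position a + 1 = φ.position b :=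
  (φ.onArrows a b e).down

theorem position_add_length {a b : V} (p : Quiver.Path a b) :
    φ.position a + p.length = φ.position b := by
  induction p with
  | nil => rfl
  | cons p e ih => rw [← φ.position_succ e, ← ih]; rfl

theorem exists_arrow_of_position {a : V} {k : ℕ} (hk : φ.position a + 1 = k) (hkn : k < n) :
    ∃ b : V, φ.position b = k ∧ Nonempty (a ⟶ b) := by
  let b : V := φ.onVertices.symm (⟨k, hkn⟩ : Fin n)
  have hb : φ.position b = k := congrArg Fin.val (φ.onVertices.apply_symm_apply (⟨k, hkn⟩ : Fin n))
  exact ⟨b, hb, ⟨(φ.onArrows a b).symm ⟨hk.trans hb.symm⟩⟩⟩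

/-- Length is the difference of positions, and the last arrow of a path is determined by its target.
-/
theorem subsingleton_path (φ : QuiverIso V (LinearQuiver n)) (a b : V) :
    Subsingleton (Quiver.Path a b) := by
  refine ⟨fun p q => ?_⟩
  induction p with
  | nil =>
    have := φ.position_add_length q
    exact (q.eq_nil_of_length_zero (by lia)).symm
  | @cons b c p e ih =>
    cases q with
    | nil =>
      have := φ.position_add_length p
      have := φ.position_succ e
      lia
    | @cons b' _ q f =>
      have h1 := φ.position_succ e
      have h2 := φ.position_succ f
      obtain rfl : b = b' := φ.position_injective (by lia)
      rw [ih q, (φ.onArrows b c).injective (Subsingleton.elim (α := PLift _)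
        (φ.onArrows b c e) (φ.onArrows b c f))]

theorem nonempty_path_iff (a b : V) :
    Nonempty (Quiver.Path a b) ↔ φ.position a ≤ φ.position b := by
  constructor
  · rintro ⟨p⟩
    have := φ.position_add_length p
    lia
  · intro h
    obtain ⟨k, hk⟩ := Nat.exists_eq_add_of_le h
    induction k generalizing a with
    | zero =>
      obtain rfl : a = b := φ.position_injective (by lia)
      exact ⟨Quiver.Path.nil⟩
    | succ k ih =>
      have hb : φ.position b < n := Fin.isLt (φ.onVertices b)
      obtain ⟨c, hc, ⟨e⟩⟩ := φ.exists_arrow_of_position (a := a) rfl (by lia)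
      obtain ⟨p⟩ := ih c (by lia) (by lia)
      exact ⟨e.toPath.comp p⟩

end QuiverIso

end

/-! ### The dominant dimension of a path algebra. -/

theorem mainTheorem1 {K : Type*} [Field K] {V : Type*} [Quiver V] [Fintype V]
    [∀ a b : V, Finite (a ⟶ b)] (hconn : QuiverConnected V) (hacyc : QuiverAcyclic V) :
    (∀ n : ℕ, 2 ≤ n → Nonempty (QuiverIso V (LinearQuiver n)) →
      dominantDimension (PathAlgebra K V) = 1) ∧
    ((∀ n : ℕ, 1 ≤ n → ¬ Nonempty (QuiverIso V (LinearQuiver n))) →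
      dominantDimension (PathAlgebra K V) = 0) := by
  constructor
  · rintro n hn ⟨φ⟩
    let _ : LinearOrder V := LinearOrder.lift' φ.position φ.position_injective
    have := hconn.1
    -- Since `n ≥ 2`, the first vertex has an outgoing arrow `β`, which is what the upper bound
    -- needs.
    let a : V := φ.onVertices.symm (⟨0, by lia⟩ : Fin n)
    have ha : φ.position a = 0 :=
      congrArg Fin.val (φ.onVertices.apply_symm_apply (⟨0, by lia⟩ : Fin n))
    obtain ⟨b, -, ⟨β⟩⟩ := φ.exists_arrow_of_position (a := a) (k := 1) (by lia) (by lia)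
    exact (moduleDominantDimension_eq (n := 1)
      (Or.inr (ThinModule.dominantDimensionGE_one φ.nonempty_path_iff φ.subsingleton_path))
      fun m hm => PathAlgebra.not_dominantDimensionGE β hm).trans Nat.cast_one
  · intro h
    refine (moduleDominantDimension_eq (n := 0) (Or.inl rfl) fun m hm hge => ?_).trans Nat.cast_zero
    obtain ⟨hout, hin⟩ := PathAlgebra.subsingleton_arrows_of_dominantDimensionGE hm hge
    obtain ⟨n, hn, hiso⟩ := exists_quiverIso_linearQuiver hconn hacyc hout hin
    exact h n hn hiso
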